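/- Let $(R,\mathfrak m)$ be a Noetherian local ring, $I$ an $\mathfrak m$-primary ideal of $R$, and $M$ a finitely generated $R$-module of Krull dimension $t\ge 0$ (in particular $M\neq 0$). Write $\ell_R$ for length and, for a submodule $N\subseteq M$, put $N:_M\mathfrak m=\{x\in M:\mathfrak m x\subseteq N\}$. For submodules $N,L\subseteq M$, put $N:_R L=\{a\in R: aL\subseteq N\}$. Put $s=\max(t-1,0)$. Then there are unique integers $\mathrm e_I^0(M),\dots,\mathrm e_I^t(M)$ and $\mathrm f_I^0(M),\dots,\mathrm f_I^{s}(M)$ such that, for all $n\gg 0$, the following two lengths are finite and $$\ell_R(M/I^{n+1}M)=\sum_{i=0}^{t}(-1)^i\,\mathrm e_I^i(M)\binom{n+t-i}{t-i},\qquad \ell_R\big((I^{n+1}M:_M\mathfrak m)/I^{n+1}M\big)=\sum_{i=0}^{s}(-1)^i\,\mathrm f_I^i(M)\binom{n+s-i}{s-i}.$$ The integer $\mathrm e_I^0(M)$ is the Hilbert multiplicity and $\mathrm f_I^0(M)$ the irreducible multiplicity of $M$ with respect to $I$ (for $t=0$, $\mathrm f_I^0(M)$ is the eventual constant value of the second length).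 Moreover $\ell_R((0):_M\mathfrak m)<\infty$, and $$\mathrm f_I^0(M)\le\begin{cases}\mathrm e_I^0(M) & \text{if } t\neq 1,\\ \mathrm e_I^0(M)+\ell_R((0):_M\mathfrak m) & \text{if } t=1.\end{cases}$$ Furthermore, if $t\ge 1$ and $\mathfrak m=I^{n+1}M:_R I^nM$ for some $n\ge 0$, then equality holds in the case of this inequality that applies to $t$. -/

import Mathlib

open IsLocalRing Filter

/-- The submodule `N :_M J = {x ∈ M | J x ⊆ N}` of `M`, for a submodule `N` of `M` and an ideal
`J` of `R`. -/
def moduleColon {R M : Type*} [CommRing R] [AddCommGroup M] [Module R M]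
    (N : Submodule R M) (J : Ideal R) : Submodule R M where
  carrier := {x | ∀ a ∈ J, a • x ∈ N}
  add_mem' hx hy a ha := by
    rw [smul_add]
    exact N.add_mem (hx a ha) (hy a ha)
  zero_mem' a _ := by
    rw [smul_zero]
    exact N.zero_mem
  smul_mem' r x hx a ha := by
    rw [smul_comm]
    exact N.smul_mem r (hx a ha)

/-- The Hilbert-Samuel function `n ↦ ℓ_R(M / I^{n+1} M)`. -/
noncomputable def hilbertFunction {R : Type*} (M : Type*) [CommRing R] [AddCommGroup M]
    [Module R M] (I : Ideal R) (n : ℕ) : ℕ∞ :=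
  Module.length R (M ⧸ (I ^ (n + 1) • ⊤ : Submodule R M))

/-- The irreducibility function `n ↦ ℓ_R((I^{n+1} M :_M 𝔪) / I^{n+1} M)`. -/
noncomputable def irreducibilityFunction {R : Type*} (M : Type*) [CommRing R] [IsLocalRing R]
    [AddCommGroup M] [Module R M] (I : Ideal R) (n : ℕ) : ℕ∞ :=
  Module.length R
    (moduleColon (I ^ (n + 1) • ⊤ : Submodule R M) (maximalIdeal R) ⧸
      (I ^ (n + 1) • ⊤ : Submodule R M).submoduleOf
        (moduleColon (I ^ (n + 1) • ⊤ : Submodule R M) (maximalIdeal R)))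

/-- The integers `c 0, …, c d` are the coefficients of the length function `φ` in degree `d`:
for all `n ≫ 0` the length `φ n` is finite and
`φ n = c₀ * (n + d choose d) - c₁ * (n + d - 1 choose d - 1) + ⋯ + (-1) ^ d * c_d`. -/
def IsBinomialCoefficients (φ : ℕ → ℕ∞) (d : ℕ) (c : Fin (d + 1) → ℤ) : Prop :=
  ∀ᶠ n : ℕ in atTop, φ n ≠ ⊤ ∧
    ((φ n).toNat : ℤ) =
      ∑ i : Fin (d + 1), (-1) ^ (i : ℕ) * c i * ((n + d - i).choose (d - i) : ℤ)

/-- The coefficient `c 0` of the expansion of `φ` in degree `d` (it is unique if the expansion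
exists; the value is `0` by convention if there is none). -/
noncomputable def leadingBinomialCoefficient (φ : ℕ → ℕ∞) (d : ℕ) : ℤ :=
  open Classical in
  if h : ∃ c : Fin (d + 1) → ℤ, IsBinomialCoefficients φ d c then h.choose 0 else 0

/-- The Hilbert multiplicity `e_I^0(M)` of a module `M` of dimension `t`. -/
noncomputable def hilbertMultiplicity {R : Type*} (M : Type*) [CommRing R]
    [AddCommGroup M] [Module R M] (I : Ideal R) (t : ℕ) : ℤ :=
  leadingBinomialCoefficient (hilbertFunction M I) t

/-- The irreducible multiplicity `f_I^0(M)` of a module `M` of dimension `t`: the leading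
coefficient of the irreducibility function in degree `t - 1`. Here `t - 1` is truncated: for
`t = 0` the irreducibility function is constant for `n ≫ 0`, and `f_I^0(M)` is that constant,
namely `ℓ_R(0 :_M 𝔪)`. -/
noncomputable def irreducibleMultiplicity {R : Type*} (M : Type*) [CommRing R] [IsLocalRing R]
    [AddCommGroup M] [Module R M] (I : Ideal R) (t : ℕ) : ℤ :=
  leadingBinomialCoefficient (irreducibilityFunction M I) (t - 1)

/-! Write `G n` for the length of `I ^ n M / I ^ (n + 1) M`, `L n` for the length of the degree `n`
part of the socle of the associated graded module, and `z` for the length of `0 :_M 𝔪`. The key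
point (`eventually_moduleColon_pow_smul_top_eq_sup`) is that for large `n` the module `I ^ (n + 1) M
:_M 𝔪` is the sum of its part inside `I ^ n M` and `0 :_M 𝔪`. By Artin-Rees these meet in zero, so
the irreducibility function is eventually `L + z`.

Both `G` and `L` are Hilbert functions of finitely generated graded modules, hence eventually
polynomial (`eventuallyDiffZero_relLength`). A comparison with a parameter ideal bounds the degree
of the Hilbert-Samuel polynomial by `t` (`eventuallyDiffZero_hilbertFunction`), so `G` has degree
less than `t`, and so does `L`, because `0 ≤ L ≤ G`. Comparing the coefficients of `L + z ≤ G + z`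
in degree `t - 1` gives the inequality for `t ≥ 1`; the constant `z` counts only when `t = 1`. If
`𝔪` is the colon ideal in the hypothesis, then `𝔪` kills the associated graded module in all large
degrees, so `L = G` there and equality follows.

Polynomial behaviour is expressed throughout by vanishing iterated differences. -/

/-! ### Lengths of subquotients. -/

section RelLength

variable {R M N : Type*} [CommRing R] [AddCommGroup M] [Module R M] [AddCommGroup N] [Module R N]

/-- The length of the subquotient `B / (A ∩ B)` of a module. -/
noncomputable def relLength (A B : Submodule R M) : ℕ∞ :=
  Module.length R (B ⧸ A.submoduleOf B)

theorem relLength_eq_length_of_surjective {P : Type*} [AddCommGroup P] [Module R P]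
    {A B : Submodule R M} (φ : B →ₗ[R] P) (hφ : Function.Surjective φ)
    (hker : LinearMap.ker φ = A.submoduleOf B) : relLength A B = Module.length R P := by
  rw [relLength, ← hker]
  exact (φ.quotKerEquivOfSurjective hφ).length_eq

theorem relLength_top (A : Submodule R M) : relLength A ⊤ = Module.length R (M ⧸ A) := by
  refine relLength_eq_length_of_surjective (A.mkQ.comp (⊤ : Submodule R M).subtype) ?_ ?_
  · intro y
    obtain ⟨x, rfl⟩ := A.mkQ_surjective y
    exact ⟨⟨x, trivial⟩, rfl⟩
  · rw [LinearMap.ker_comp, Submodule.ker_mkQ]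
    rfl

theorem relLength_bot (B : Submodule R M) : relLength ⊥ B = Module.length R B := by
  refine relLength_eq_length_of_surjective LinearMap.id Function.surjective_id ?_
  rw [LinearMap.ker_id, Submodule.submoduleOf, Submodule.comap_bot, Submodule.ker_subtype]

theorem relLength_eq_zero_of_le {A B : Submodule R M} (h : B ≤ A) : relLength A B = 0 := by
  rw [relLength, Submodule.submoduleOf_eq_top.mpr h, Module.length_eq_zero_iff]
  infer_instance

theorem relLength_add {A B C : Submodule R M} (hAB : A ≤ B) (hBC : B ≤ C) :
    relLength A C = relLength A B + relLength B C := by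
  have h₁ : A.submoduleOf B = (A.submoduleOf C).comap (Submodule.inclusion hBC) := rfl
  have h₂ : A.submoduleOf C ≤ (B.submoduleOf C).comap LinearMap.id := fun x hx => hAB hx
  refine Module.length_eq_add_of_exact
    (Submodule.mapQ (A.submoduleOf B) (A.submoduleOf C) (Submodule.inclusion hBC) h₁.le)
    (Submodule.mapQ (A.submoduleOf C) (B.submoduleOf C) LinearMap.id h₂) ?_ ?_ ?_
  · rw [← LinearMap.ker_eq_bot, Submodule.ker_mapQ, ← h₁, Submodule.mkQ_map_self]
  · intro y
    obtain ⟨x, rfl⟩ := Submodule.mkQ_surjective _ y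
    exact ⟨Submodule.Quotient.mk x, rfl⟩
  · intro y
    obtain ⟨x, rfl⟩ := Submodule.mkQ_surjective _ y
    constructor
    · intro h
      have h' : x ∈ B.submoduleOf C := (Submodule.Quotient.mk_eq_zero _).mp h
      exact ⟨Submodule.Quotient.mk ⟨x, h'⟩, rfl⟩
    · rintro ⟨z, hz⟩
      obtain ⟨b, rfl⟩ := Submodule.mkQ_surjective _ z
      rw [← hz]
      exact (Submodule.Quotient.mk_eq_zero _).mpr b.2

/-- The map `φ` induces an isomorphism between the two subquotients. For multiplication by a ring
element this compares the coimage with the image, as in the four-term exact sequence of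
Hilbert-Serre. -/
theorem relLength_inf_comap (φ : M →ₗ[R] N) (A : Submodule R N) (B : Submodule R M) :
    relLength (B ⊓ A.comap φ) B = relLength A (A ⊔ B.map φ) := by
  have hmem : ∀ b : B, φ b ∈ A ⊔ B.map φ := fun b =>
    Submodule.mem_sup_right (Submodule.mem_map_of_mem b.2)
  refine relLength_eq_length_of_surjective
    ((A.submoduleOf (A ⊔ B.map φ)).mkQ.comp ((φ.comp B.subtype).codRestrict _ hmem)) ?_ ?_
  · intro y
    obtain ⟨⟨x, hx⟩, rfl⟩ := Submodule.mkQ_surjective _ y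
    obtain ⟨a, ha, _, ⟨b, hb, rfl⟩, rfl⟩ := Submodule.mem_sup.mp hx
    refine ⟨⟨b, hb⟩, (Submodule.Quotient.eq _).mpr ?_⟩
    change φ b - (a + φ b) ∈ A
    rw [sub_add_cancel_right]
    exact A.neg_mem ha
  · ext b
    rw [LinearMap.ker_comp, Submodule.ker_mkQ]
    change φ b ∈ A ↔ (b : M) ∈ B ∧ φ b ∈ A
    simp

theorem relLength_sup (A B : Submodule R M) : relLength A (A ⊔ B) = relLength (A ⊓ B) B := by
  have := relLength_inf_comap LinearMap.id A B
  rw [Submodule.map_id, Submodule.comap_id, inf_comm] at this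
  exact this.symm

theorem relLength_le_of_le {A B C : Submodule R M} (hAB : A ≤ B) (hBC : B ≤ C) :
    relLength A B ≤ relLength A C := by
  rw [relLength_add hAB hBC]
  exact le_self_add

theorem relLength_le_of_le_left {A B C : Submodule R M} (hAB : A ≤ B) (hBC : B ≤ C) :
    relLength B C ≤ relLength A C := by
  rw [relLength_add hAB hBC]
  exact le_add_self

theorem relLength_toNat_add {A B C : Submodule R M} (hAB : A ≤ B) (hBC : B ≤ C)
    (h : relLength A C ≠ ⊤) :
    ((relLength A C).toNat : ℤ) = (relLength A B).toNat + (relLength B C).toNat := by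
  have hadd := relLength_add hAB hBC
  rw [hadd, ENat.toNat_add, Nat.cast_add]
  · exact ne_top_of_le_ne_top h (relLength_le_of_le hAB hBC)
  · exact ne_top_of_le_ne_top h (relLength_le_of_le_left hAB hBC)

end RelLength

/-! ### Finite length of modules killed by a power of the maximal ideal. -/

section FiniteLength

variable {R M : Type*} [CommRing R] [IsLocalRing R] [IsNoetherianRing R]
  [AddCommGroup M] [Module R M] [Module.Finite R M]

/-- The exponent is positive, so the power lies in the maximal ideal, which is then a minimal prime
over it. -/
theorem isArtinianRing_quotient_maximalIdeal_pow (k : ℕ) :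
    IsArtinianRing (R ⧸ maximalIdeal R ^ (k + 1)) := by
  refine quotient_artinian_of_mem_minimalPrimes_of_isLocalRing _ ⟨⟨inferInstance, ?_⟩, ?_⟩
  · exact Ideal.pow_le_self k.succ_ne_zero
  · intro p hp _
    exact hp.1.le_of_pow_le hp.2

theorem length_ne_top_of_maximalIdeal_pow_smul_eq_bot {k : ℕ}
    (h : maximalIdeal R ^ k • (⊤ : Submodule R M) = ⊥) : Module.length R M ≠ ⊤ := by
  have hart := isArtinianRing_quotient_maximalIdeal_pow (R := R) k
  have htors : Module.IsTorsionBySet R M (maximalIdeal R ^ (k + 1) : Ideal R) := by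
    rw [Module.isTorsionBySet_iff_subset_annihilator]
    change maximalIdeal R ^ (k + 1) ≤ _
    refine (Ideal.pow_le_pow_right k.le_succ).trans ?_
    rw [← Submodule.annihilator_top]
    exact Submodule.le_annihilator_iff.mpr h
  let _ := htors.module
  have : IsScalarTower R (R ⧸ maximalIdeal R ^ (k + 1)) M := htors.isScalarTower
  have : Module.Finite (R ⧸ maximalIdeal R ^ (k + 1)) M :=
    Module.Finite.of_restrictScalars_finite R _ M
  have : IsArtinian (R ⧸ maximalIdeal R ^ (k + 1)) M := inferInstance
  have : IsArtinian R M :=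
    (LinearMap.isArtinian_iff_of_bijective htors.semilinearMap Function.bijective_id).mpr this
  have : IsNoetherian R M := inferInstance
  exact Module.length_ne_top

theorem relLength_ne_top_of_maximalIdeal_pow_smul_le {k : ℕ} {A B : Submodule R M}
    (h : maximalIdeal R ^ k • B ≤ A) : relLength A B ≠ ⊤ := by
  refine length_ne_top_of_maximalIdeal_pow_smul_eq_bot (k := k) ?_
  rw [eq_bot_iff, Submodule.smul_le]
  intro r hr y _
  obtain ⟨x, rfl⟩ := Submodule.mkQ_surjective _ y
  rw [← map_smul]
  exact (Submodule.Quotient.mk_eq_zero _).mpr (h (Submodule.smul_mem_smul hr x.2))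

end FiniteLength

/-! ### Eventually polynomial integer functions and their binomial expansions. -/

section Differences

open fwdDiff

/-- The `d`-th difference of the function `f` vanishes for large arguments, that is, `f` is
eventually a polynomial function of degree less than `d`. -/
def EventuallyDiffZero (d : ℕ) (f : ℕ → ℤ) : Prop :=
  ∀ᶠ n in atTop, (Δ_[1])^[d] f n = 0

theorem fwdDiff_iter_eventuallyEq {f g : ℕ → ℤ} (h : f =ᶠ[atTop] g) (d : ℕ) :
    (Δ_[1])^[d] f =ᶠ[atTop] (Δ_[1])^[d] g := by
  induction d with
  | zero => exact h
  | succ d ih =>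
    filter_upwards [ih, (tendsto_add_atTop_nat 1).eventually ih] with n h₁ h₂
    rw [Function.iterate_succ_apply', Function.iterate_succ_apply', fwdDiff, fwdDiff, h₁, h₂]

theorem fwdDiff_iter_sub (f g : ℕ → ℤ) (d : ℕ) :
    (Δ_[1])^[d] (f - g) = (Δ_[1])^[d] f - (Δ_[1])^[d] g := by
  rw [eq_sub_iff_add_eq, ← fwdDiff_iter_add, sub_add_cancel]

theorem eventually_const_of_fwdDiff_eq_zero {f : ℕ → ℤ}
    (h : ∀ᶠ n in atTop, Δ_[1] f n = 0) : ∃ a, ∀ᶠ n in atTop, f n = a := by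
  obtain ⟨N, hN⟩ := eventually_atTop.mp h
  refine ⟨f N, eventually_atTop.mpr ⟨N, fun n hn => ?_⟩⟩
  induction n, hn using Nat.le_induction with
  | base => rfl
  | succ n hn ih => rw [← ih, ← sub_eq_zero]; exact hN n hn

/-- A function whose difference is eventually at most `-1` decreases without bound, so it is itself
eventually at most `-1`; this is iterated `d` times. -/
theorem eventually_le_neg_one_of_fwdDiff_iter {f : ℕ → ℤ} {d : ℕ}
    (h : ∀ᶠ n in atTop, (Δ_[1])^[d] f n ≤ -1) : ∀ᶠ n in atTop, f n ≤ -1 := by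
  induction d with
  | zero => exact h
  | succ d ih =>
    refine ih ?_
    obtain ⟨N, hN⟩ := eventually_atTop.mp h
    set g := (Δ_[1])^[d] f
    have key : ∀ k : ℕ, g (N + k) ≤ g N - k := by
      intro k
      induction k with
      | zero => simp
      | succ k ihk =>
        have h₁ := hN (N + k) (Nat.le_add_right _ _)
        rw [Function.iterate_succ_apply', fwdDiff] at h₁
        rw [← add_assoc]
        push_cast
        linarith
    refine eventually_atTop.mpr ⟨N + (g N).toNat + 1, fun n hn => ?_⟩
    obtain ⟨k, rfl⟩ := Nat.exists_eq_add_of_le (show N ≤ n by omega)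
    have h₁ := key k
    have h₂ := Int.self_le_toNat (g N)
    have h₃ : ((g N).toNat : ℤ) + 1 ≤ k := by exact_mod_cast (by omega : (g N).toNat + 1 ≤ k)
    linarith

theorem le_of_fwdDiff_iter_eventually_eq {f g : ℕ → ℤ} {d : ℕ} {a b : ℤ}
    (hfg : ∀ᶠ n in atTop, f n ≤ g n) (hf : ∀ᶠ n in atTop, (Δ_[1])^[d] f n = a)
    (hg : ∀ᶠ n in atTop, (Δ_[1])^[d] g n = b) : a ≤ b := by
  by_contra! hlt
  have h : ∀ᶠ n in atTop, (g - f) n ≤ -1 := by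
    refine eventually_le_neg_one_of_fwdDiff_iter (d := d) ?_
    filter_upwards [hf, hg] with n h₁ h₂
    rw [fwdDiff_iter_sub, Pi.sub_apply, h₁, h₂]
    linarith
  obtain ⟨n, h₁, h₂⟩ := (h.and hfg).exists
  rw [Pi.sub_apply] at h₁
  linarith

namespace EventuallyDiffZero

variable {d e : ℕ} {f g : ℕ → ℤ}

theorem congr (hf : EventuallyDiffZero d f) (h : g =ᶠ[atTop] f) : EventuallyDiffZero d g := by
  filter_upwards [hf, fwdDiff_iter_eventuallyEq h d] with n h₁ h₂
  rw [h₂, h₁]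

theorem add (hf : EventuallyDiffZero d f) (hg : EventuallyDiffZero d g) :
    EventuallyDiffZero d (f + g) := by
  filter_upwards [hf, hg] with n h₁ h₂
  rw [fwdDiff_iter_add, Pi.add_apply, h₁, h₂, add_zero]

theorem sub (hf : EventuallyDiffZero d f) (hg : EventuallyDiffZero d g) :
    EventuallyDiffZero d (f - g) := by
  filter_upwards [hf, hg] with n h₁ h₂
  rw [fwdDiff_iter_sub, Pi.sub_apply, h₁, h₂, sub_zero]

theorem succ (hf : EventuallyDiffZero d f) : EventuallyDiffZero (d + 1) f := by
  filter_upwards [hf, (tendsto_add_atTop_nat 1).eventually hf] with n h₁ h₂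
  rw [Function.iterate_succ_apply', fwdDiff, h₁, h₂, sub_zero]

theorem mono (hf : EventuallyDiffZero d f) (h : d ≤ e) : EventuallyDiffZero e f := by
  induction e, h using Nat.le_induction with
  | base => exact hf
  | succ e _ ih => exact ih.succ

theorem shift (hf : EventuallyDiffZero d f) (m : ℕ) :
    EventuallyDiffZero d fun n => f (n + m) := by
  filter_upwards [(tendsto_add_atTop_nat m).eventually hf] with n h
  rw [fwdDiff_iter_comp_add, h]

theorem of_shift {m : ℕ} (hf : EventuallyDiffZero d fun n => f (n + m)) :
    EventuallyDiffZero d f := by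
  rw [EventuallyDiffZero, ← map_add_atTop_eq_nat m, eventually_map]
  filter_upwards [hf] with n h
  rwa [fwdDiff_iter_comp_add] at h

theorem of_fwdDiff (hf : EventuallyDiffZero d (Δ_[1] f)) : EventuallyDiffZero (d + 1) f := hf

theorem fwdDiff (hf : EventuallyDiffZero (d + 1) f) : EventuallyDiffZero d (Δ_[1] f) := hf

theorem const (a : ℤ) : EventuallyDiffZero (d + 1) fun _ => a := by
  refine mono (d := 1) (Eventually.of_forall fun n => ?_) (Nat.le_add_left 1 d)
  rw [Function.iterate_one, fwdDiff_const]

theorem sum {ι : Type*} {s : Finset ι} {F : ι → ℕ → ℤ}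
    (h : ∀ i ∈ s, EventuallyDiffZero d (F i)) :
    EventuallyDiffZero d (fun n => ∑ i ∈ s, F i n) := by
  have := (Finset.eventually_all s).mpr h
  filter_upwards [this] with n hn
  have h₁ : (fun n => ∑ i ∈ s, F i n) = ∑ i ∈ s, F i := by
    ext n
    rw [Finset.sum_apply]
  rw [h₁, fwdDiff_iter_finsetSum, Finset.sum_apply]
  exact Finset.sum_eq_zero hn

/-- One step of `n ↦ f (c * n + b)` telescopes into `c` consecutive values of the difference of `f`,
which has lower degree. -/
theorem comp_mul_add (hf : EventuallyDiffZero d f) {c : ℕ} (hc : 0 < c) (b : ℕ) :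
    EventuallyDiffZero d fun n => f (c * n + b) := by
  induction d generalizing f b with
  | zero =>
    refine Tendsto.eventually (f := fun n => c * n + b) ?_ hf
    exact tendsto_atTop_mono (fun n => (Nat.le_mul_of_pos_left n hc).trans (Nat.le_add_right _ b))
      tendsto_id
  | succ d ih =>
    refine of_fwdDiff ?_
    have h : Δ_[1] (fun n => f (c * n + b)) =
        fun n => ∑ i ∈ Finset.range c, (Δ_[1] f) (c * n + (b + i)) := by
      ext n
      have := Finset.sum_range_sub (fun i => f (c * n + b + i)) c
      rw [_root_.fwdDiff]
      simp only [_root_.fwdDiff, ← add_assoc] at this ⊢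
      rw [this, add_zero, mul_add, mul_one, add_right_comm]
    rw [h]
    exact sum fun i _ => ih hf.fwdDiff _

theorem exists_fwdDiff_iter_eq (hf : EventuallyDiffZero (d + 1) f) :
    ∃ a, ∀ᶠ n in atTop, (Δ_[1])^[d] f n = a := by
  refine eventually_const_of_fwdDiff_eq_zero ?_
  filter_upwards [hf] with n hn
  rwa [Function.iterate_succ_apply'] at hn

/-- While the degree bound of `f` exceeds that of `g`, the top difference of `f` is eventually
constant. It is nonnegative since `0 ≤ f` and nonpositive since `f ≤ g`, so it vanishes and the
bound drops by one. -/
theorem of_le (hf : EventuallyDiffZero d f) (hg : EventuallyDiffZero e g)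
    (h₀ : ∀ᶠ n in atTop, 0 ≤ f n) (h : ∀ᶠ n in atTop, f n ≤ g n) : EventuallyDiffZero e f := by
  induction d with
  | zero => exact hf.mono (Nat.zero_le e)
  | succ d ih =>
    rcases Nat.lt_or_ge d e with hde | hde
    · exact hf.mono hde
    refine ih ?_
    obtain ⟨a, ha⟩ := hf.exists_fwdDiff_iter_eq
    have h₁ : a ≤ 0 := le_of_fwdDiff_iter_eventually_eq h ha (hg.mono hde)
    have h₂ : 0 ≤ a := le_of_fwdDiff_iter_eventually_eq (f := fun _ => 0) (d := d) h₀
      (Eventually.of_forall fun n =>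
        congrFun (Function.iterate_fixed (fwdDiff_const (M := ℕ) 1 (0 : ℤ)) d) n) ha
    filter_upwards [ha] with n hn
    rw [hn]
    exact le_antisymm h₁ h₂

end EventuallyDiffZero

/-- The function `n ↦ ∑ i, (-1) ^ i * c i * (n + d - i choose d - i)`. -/
def binomialSum (d : ℕ) (c : Fin (d + 1) → ℤ) (n : ℕ) : ℤ :=
  ∑ i : Fin (d + 1), (-1) ^ (i : ℕ) * c i * ((n + d - i).choose (d - i) : ℤ)

theorem binomialSum_zero (c : Fin 1 → ℤ) (n : ℕ) : binomialSum 0 c n = c 0 := by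
  simp [binomialSum]

theorem binomialSum_succ (d : ℕ) (c : Fin (d + 2) → ℤ) :
    binomialSum (d + 1) c =
      (c 0 • fun n : ℕ => ((n + (d + 1)).choose (d + 1) : ℤ)) -
        binomialSum d (fun i => c i.succ) := by
  ext n
  rw [binomialSum, Fin.sum_univ_succ, Pi.sub_apply, binomialSum, sub_eq_add_neg,
    ← Finset.sum_neg_distrib]
  congr 1
  · simp
  · refine Finset.sum_congr rfl fun i _ => ?_
    rw [Fin.val_succ, Nat.add_sub_add_right, ← add_assoc, Nat.add_sub_add_right, pow_succ]
    ring

theorem fwdDiff_iter_add_choose (d : ℕ) :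
    (Δ_[1])^[d] (fun n : ℕ => ((n + d).choose d : ℤ)) = fun _ => 1 := by
  ext n
  rw [fwdDiff_iter_comp_add 1 (fun n : ℕ => (n.choose d : ℤ)) d d n]
  have := fwdDiff_iter_choose (j := 0) (k := d)
  simp only [add_zero, Nat.choose_zero_right, Nat.cast_one] at this
  rw [this]

theorem fwdDiff_iter_binomialSum (d : ℕ) (c : Fin (d + 1) → ℤ) :
    (Δ_[1])^[d] (binomialSum d c) = fun _ => c 0 := by
  induction d with
  | zero => ext n; exact binomialSum_zero c n
  | succ d ih =>
    rw [binomialSum_succ, fwdDiff_iter_sub, fwdDiff_iter_const_smul, fwdDiff_iter_add_choose,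
      Function.iterate_succ_apply', ih, fwdDiff_const]
    ext n
    simp

theorem EventuallyDiffZero.exists_binomialSum {d : ℕ} {f : ℕ → ℤ}
    (hf : EventuallyDiffZero (d + 1) f) : ∃ c, f =ᶠ[atTop] binomialSum d c := by
  induction d generalizing f with
  | zero =>
    obtain ⟨a, ha⟩ := hf.exists_fwdDiff_iter_eq
    refine ⟨fun _ => a, ?_⟩
    filter_upwards [ha] with n hn
    rw [binomialSum_zero]
    exact hn
  | succ d ih =>
    obtain ⟨a, ha⟩ := hf.exists_fwdDiff_iter_eq
    have hg : EventuallyDiffZero (d + 1)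
        (f - a • fun n : ℕ => ((n + (d + 1)).choose (d + 1) : ℤ)) := by
      filter_upwards [ha] with n hn
      rw [fwdDiff_iter_sub, fwdDiff_iter_const_smul, fwdDiff_iter_add_choose, Pi.sub_apply, hn]
      simp
    obtain ⟨c, hc⟩ := ih hg
    -- Removing the leading term shifts the index by one and so reverses all the alternating signs.
    refine ⟨Fin.cons a (-c), ?_⟩
    filter_upwards [hc] with n hn
    rw [binomialSum_succ, Pi.sub_apply]
    simp only [Fin.cons_zero, Fin.cons_succ, Pi.sub_apply, Pi.neg_apply] at hn ⊢
    have hneg : binomialSum d (fun i => -c i) n = -binomialSum d c n := by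
      simp [binomialSum, Finset.sum_neg_distrib]
    rw [hneg, ← hn]
    ring

theorem binomialSum_injective {d : ℕ} {c c' : Fin (d + 1) → ℤ}
    (h : binomialSum d c =ᶠ[atTop] binomialSum d c') : c = c' := by
  have h₀ : c 0 = c' 0 := by
    have := fwdDiff_iter_eventuallyEq h d
    rw [fwdDiff_iter_binomialSum, fwdDiff_iter_binomialSum] at this
    obtain ⟨n, hn⟩ := this.exists
    exact hn
  induction d with
  | zero =>
    ext i
    rw [Fin.fin_one_eq_zero i, h₀]
  | succ d ih =>
    have h' : binomialSum d (fun i => c i.succ) =ᶠ[atTop] binomialSum d fun i => c' i.succ := by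
      filter_upwards [h] with n hn
      rw [binomialSum_succ, binomialSum_succ, h₀, Pi.sub_apply, Pi.sub_apply] at hn
      exact sub_right_injective hn
    have h'' := ih h' (by
      have := fwdDiff_iter_eventuallyEq h' d
      rw [fwdDiff_iter_binomialSum, fwdDiff_iter_binomialSum] at this
      obtain ⟨n, hn⟩ := this.exists
      exact hn)
    ext i
    refine Fin.cases h₀ (fun j => congrFun h'' j) i

theorem existsUnique_isBinomialCoefficients {φ : ℕ → ℕ∞} {d : ℕ}
    (hfin : ∀ᶠ n in atTop, φ n ≠ ⊤)
    (h : EventuallyDiffZero (d + 1) fun n => ((φ n).toNat : ℤ)) :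
    ∃! c, IsBinomialCoefficients φ d c := by
  obtain ⟨c, hc⟩ := h.exists_binomialSum
  refine ⟨c, ?_, fun c' hc' => binomialSum_injective ?_⟩
  · filter_upwards [hfin, hc] with n h₁ h₂
    exact ⟨h₁, h₂⟩
  · filter_upwards [hc, hc'] with n h₁ h₂
    exact h₂.2.symm.trans h₁

theorem fwdDiff_iter_eventually_eq_leadingBinomialCoefficient {φ : ℕ → ℕ∞} {d : ℕ}
    (h : ∃ c, IsBinomialCoefficients φ d c) :
    ∀ᶠ n in atTop,
      (Δ_[1])^[d] (fun n => ((φ n).toNat : ℤ)) n = leadingBinomialCoefficient φ d := by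
  have hc := h.choose_spec
  have h₁ : (fun n => ((φ n).toNat : ℤ)) =ᶠ[atTop] binomialSum d h.choose := by
    filter_upwards [hc] with n hn
    exact hn.2
  filter_upwards [fwdDiff_iter_eventuallyEq h₁ d] with n hn
  rw [hn, fwdDiff_iter_binomialSum, leadingBinomialCoefficient, dif_pos h]

end Differences

/-! ### Noetherianity of the Rees module and the Hilbert-Serre theorem. -/

section Rees

variable {R M : Type*} [CommRing R] [AddCommGroup M] [Module R M]

theorem Ideal.pow_smul_le_of_smul_le {I : Ideal R} {B : ℕ → Submodule R M}
    (h : ∀ n, I • B n ≤ B (n + 1)) (i j : ℕ) : I ^ i • B j ≤ B (i + j) := by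
  induction i with
  | zero => simp
  | succ i ih =>
    rw [pow_succ', mul_smul, add_right_comm]
    exact (smul_mono_right I ih).trans (h _)

/-- The submodule `⨁ B n` of `M[X]` over the Rees algebra of `I`, for a sequence of submodules
with `I B n ⊆ B (n + 1)`. -/
noncomputable def reesSubmodule (I : Ideal R) (B : ℕ → Submodule R M)
    (h : ∀ n, I • B n ≤ B (n + 1)) : Submodule (reesAlgebra I) (PolynomialModule R M) where
  carrier := {f | ∀ i, f.coeff i ∈ B i}
  add_mem' hf hg i := Submodule.add_mem _ (hf i) (hg i)
  zero_mem' _ := Submodule.zero_mem _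
  smul_mem' r f hf i := by
    rw [Subalgebra.smul_def, PolynomialModule.smul_apply]
    apply Submodule.sum_mem
    rintro ⟨j, k⟩ e
    rw [Finset.HasAntidiagonal.mem_antidiagonal] at e
    subst e
    exact Ideal.pow_smul_le_of_smul_le h j k (Submodule.smul_mem_smul (r.2 j) (hf k))

theorem le_of_reesSubmodule_le {I : Ideal R} {B C : ℕ → Submodule R M}
    {hB : ∀ n, I • B n ≤ B (n + 1)} {hC : ∀ n, I • C n ≤ C (n + 1)}
    (h : reesSubmodule I B hB ≤ reesSubmodule I C hC) (n : ℕ) : B n ≤ C n := by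
  intro x hx
  have hmem : PolynomialModule.single R n x ∈ reesSubmodule I B hB := by
    intro i
    rw [PolynomialModule.coeff_single, Finsupp.single_apply]
    split_ifs with hi
    · rwa [← hi]
    · exact (B i).zero_mem
  have := h hmem n
  rwa [PolynomialModule.coeff_single, Finsupp.single_eq_same] at this

variable [IsNoetherianRing R] [Module.Finite R M]

/-- A sequence of submodules `B n ⊆ I ^ n M` with `I B n ⊆ B (n + 1)` satisfies
`B (n + 1) = I B n` for large `n`, since the Rees module of `M` is Noetherian. -/
theorem eventually_eq_smul_of_le_pow_smul (I : Ideal R) {B : ℕ → Submodule R M}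
    (hB : ∀ n, I • B n ≤ B (n + 1)) (hle : ∀ n, B n ≤ I ^ n • ⊤) :
    ∀ᶠ n in atTop, B (n + 1) = I • B n := by
  have hfg : (I.stableFiltration (⊤ : Submodule R M)).submodule.FG :=
    ((I.stableFiltration ⊤).submodule_fg_iff_stable fun _ => IsNoetherian.noetherian _).mpr
      (I.stableFiltration_stable ⊤)
  have hnoeth := isNoetherian_of_fg_of_noetherian _ hfg
  -- `T k` is the graded submodule generated by the components of `B` in degrees up to `k`. These
  -- increase with `k`, so the chain stabilizes.
  let T : ℕ → ℕ → Submodule R M := fun k n => if n ≤ k then B n else I ^ (n - k) • B k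
  have hTB : ∀ k n, T k n ≤ B n := by
    intro k n
    simp only [T]
    split_ifs with h
    · exact le_rfl
    · have := Ideal.pow_smul_le_of_smul_le hB (n - k) k
      rwa [Nat.sub_add_cancel (le_of_not_ge h)] at this
  have hT : ∀ k n, I • T k n ≤ T k (n + 1) := by
    intro k n
    rcases Nat.lt_trichotomy n k with h | rfl | h
    · simp only [T, if_pos h.le, if_pos (Nat.succ_le_of_lt h)]
      exact hB n
    · simp only [T, le_refl, if_true, Nat.not_succ_le_self, if_false, Nat.add_sub_cancel_left,
        pow_one]
    · simp only [T, if_neg h.not_ge, if_neg (h.trans n.lt_succ_self).not_ge]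
      rw [Nat.succ_sub h.le, pow_succ', mul_smul]
  have hTmono : ∀ k n, T k n ≤ T (k + 1) n := by
    intro k n
    by_cases h : n ≤ k + 1
    · simp only [T, if_pos h]
      exact hTB k n
    · have h' : ¬ n ≤ k := fun h' => h (h'.trans k.le_succ)
      simp only [T, if_neg h, if_neg h']
      rw [show n - k = (n - (k + 1)) + 1 by omega, pow_succ, mul_smul]
      exact smul_mono_right _ (hB k)
  let F : ℕ →o Submodule (reesAlgebra I) (I.stableFiltration (⊤ : Submodule R M)).submodule :=
    ⟨fun k => (reesSubmodule I (T k) (hT k)).submoduleOf _,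
      monotone_nat_of_le_succ fun k f hf i => hTmono k i (hf i)⟩
  obtain ⟨k, hk⟩ := monotone_stabilizes_iff_noetherian.mpr hnoeth F
  have hsub : ∀ m, reesSubmodule I (T m) (hT m) ≤
      (I.stableFiltration (⊤ : Submodule R M)).submodule := fun m f hf i =>
    (hTB m i).trans (hle i) (hf i)
  have heq : ∀ m ≥ k, ∀ n, T m n ≤ T k n := by
    intro m hm
    refine le_of_reesSubmodule_le (hB := hT m) (hC := hT k) fun f hf => ?_
    have : (⟨f, hsub m hf⟩ : (I.stableFiltration (⊤ : Submodule R M)).submodule) ∈ F m := hf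
    rw [← hk m hm] at this
    exact this
  have hpow : ∀ n ≥ k, B n = I ^ (n - k) • B k := by
    intro n hn
    refine le_antisymm ?_ ?_
    · have := heq n hn n
      simp only [T, le_refl, if_true] at this
      refine this.trans ?_
      split_ifs with h
      · rw [le_antisymm h hn, Nat.sub_self, pow_zero, one_smul]
      · exact le_rfl
    · have := Ideal.pow_smul_le_of_smul_le hB (n - k) k
      rwa [Nat.sub_add_cancel hn] at this
  refine eventually_atTop.mpr ⟨k, fun n hn => ?_⟩
  rw [hpow n hn, hpow (n + 1) (hn.trans n.le_succ), Nat.succ_sub hn, pow_succ', mul_smul]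

/-- The Hilbert-Serre theorem for the graded module with components `B n / A n`. -/
theorem eventuallyDiffZero_relLength (I : Ideal R) (s : Finset R) {A B : ℕ → Submodule R M}
    (hAB : ∀ n, A n ≤ B n) (hA : ∀ n, I • A n ≤ A (n + 1)) (hB : ∀ n, I • B n ≤ B (n + 1))
    (hle : ∀ n, B n ≤ I ^ n • ⊤) (hfin : ∀ n, relLength (A n) (B n) ≠ ⊤)
    (hs : (s : Set R) ⊆ I) (J : Ideal R) (hJ : ∀ n, J • B n ≤ A (n + 1))
    (hI : I ≤ Ideal.span s ⊔ J) :
    EventuallyDiffZero s.card fun n => ((relLength (A n) (B n)).toNat : ℤ) := by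
  classical
  -- Multiplication by elements of `J` is zero from each degree of the graded module to the next.
  -- The induction moves generators of `I` one at a time from `s` into `J`.
  induction s using Finset.induction_on generalizing A B J with
  | empty =>
    rw [Finset.coe_empty, Ideal.span_empty, bot_sup_eq] at hI
    obtain ⟨N, hN⟩ := eventually_atTop.mp (eventually_eq_smul_of_le_pow_smul I hB hle)
    refine eventually_atTop.mpr ⟨N + 1, fun n hn => ?_⟩
    obtain ⟨m, rfl⟩ := Nat.exists_eq_add_of_le' (Nat.le_of_add_left_le hn)
    rw [Finset.card_empty, Function.iterate_zero_apply, relLength_eq_zero_of_le]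
    · rfl
    · rw [hN m (by omega)]
      exact (Submodule.smul_mono_left hI).trans (hJ m)
  | insert x s hx ih =>
    rw [Finset.coe_insert, Set.insert_subset_iff] at hs
    obtain ⟨hxI, hs⟩ := hs
    have hxB : ∀ n b, b ∈ B n → x • b ∈ B (n + 1) := fun n b hb =>
      hB n (Submodule.smul_mem_smul hxI hb)
    let φ := LinearMap.lsmul R M x
    -- `K n / A n` is the kernel of multiplication by `x` out of degree `n`, and `B (n + 1) / C n`
    -- is its cokernel; `x` acts as zero on both.
    let K : ℕ → Submodule R M := fun n => B n ⊓ (A (n + 1)).comap φ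
    let C : ℕ → Submodule R M := fun n => A (n + 1) ⊔ (B n).map φ
    have hAK : ∀ n, A n ≤ K n := fun n a ha =>
      ⟨hAB n ha, hA n (Submodule.smul_mem_smul hxI ha)⟩
    have hKB : ∀ n, K n ≤ B n := fun n => inf_le_left
    have hAC : ∀ n, A (n + 1) ≤ C n := fun n => le_sup_left
    have hCB : ∀ n, C n ≤ B (n + 1) := fun n =>
      sup_le (hAB _) (Submodule.map_le_iff_le_comap.mpr fun b hb => hxB n b hb)
    have hI' : I ≤ Ideal.span s ⊔ (Ideal.span {x} ⊔ J) := by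
      refine hI.trans ?_
      rw [Finset.coe_insert, Ideal.span_insert, sup_left_comm, sup_assoc]
    have hxK : ∀ n, (Ideal.span {x} ⊔ J) • K n ≤ A (n + 1) := by
      intro n
      rw [Submodule.sup_smul, Submodule.ideal_span_singleton_smul]
      refine sup_le ?_ ((smul_mono_right J (hKB n)).trans (hJ n))
      rintro _ ⟨b, hb, rfl⟩
      exact hb.2
    have hxC : ∀ n, (Ideal.span {x} ⊔ J) • B n ≤ C n := by
      intro n
      rw [Submodule.sup_smul, Submodule.ideal_span_singleton_smul]
      exact sup_le le_sup_right ((hJ n).trans le_sup_left)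
    have hIK : ∀ n, I • K n ≤ K (n + 1) := by
      intro n
      refine Submodule.smul_le.mpr fun a ha b hb => ⟨hB n (Submodule.smul_mem_smul ha hb.1), ?_⟩
      change x • a • b ∈ A (n + 1 + 1)
      rw [smul_comm]
      exact hA _ (Submodule.smul_mem_smul ha hb.2)
    have hIC : ∀ n, I • C n ≤ C (n + 1) := by
      intro n
      rw [Submodule.smul_sup]
      refine sup_le ((hA _).trans le_sup_left) (le_trans ?_ le_sup_right)
      rw [← Submodule.map_smul'']
      exact Submodule.map_mono (hB n)
    have hK := ih hAK hA hIK (fun n => (hKB n).trans (hle n))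
      (fun n => ne_top_of_le_ne_top (hfin n) (relLength_le_of_le (hAK n) (hKB n)))
      hs _ hxK hI'
    -- The cokernel is indexed by its own degree: nothing maps into degree `0`, and `C n` belongs to
    -- degree `n + 1`.
    let A' : ℕ → Submodule R M := fun n => Nat.casesOn n (A 0) C
    have hA'B : ∀ n, A' n ≤ B n := fun n => by
      cases n with
      | zero => exact hAB 0
      | succ n => exact hCB n
    have hC := ih (A := A') (B := B) hA'B
      (fun n => by
        cases n with
        | zero => exact (hA 0).trans (hAC 0)
        | succ n => exact hIC n)
      hB hle
      (fun n => by
        cases n with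
        | zero => exact hfin 0
        | succ n =>
          exact ne_top_of_le_ne_top (hfin (n + 1)) (relLength_le_of_le_left (hAC n) (hCB n)))
      hs _ hxC hI'
    rw [Finset.card_insert_of_notMem hx]
    refine EventuallyDiffZero.of_fwdDiff (((hC.shift 1).sub hK).congr
      (Eventually.of_forall fun n => ?_))
    have h₁ := relLength_toNat_add (hAK n) (hKB n) (hfin n)
    have h₂ := relLength_toNat_add (hAC n) (hCB n) (hfin (n + 1))
    have h₃ : relLength (K n) (B n) = relLength (A (n + 1)) (C n) := relLength_inf_comap φ _ _
    rw [h₃] at h₁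
    change ((relLength (A (n + 1)) (B (n + 1))).toNat : ℤ) - (relLength (A n) (B n)).toNat =
      (relLength (C n) (B (n + 1))).toNat - (relLength (A n) (K n)).toNat
    linarith

end Rees

/-! ### The Hilbert-Samuel function and its degree. -/

section HilbertFunction

open fwdDiff

variable {R M : Type*} [CommRing R] [AddCommGroup M] [Module R M]

theorem hilbertFunction_eq_relLength (I : Ideal R) (n : ℕ) :
    hilbertFunction M I n = relLength (I ^ (n + 1) • ⊤ : Submodule R M) ⊤ :=
  (relLength_top _).symm

theorem pow_succ_smul_top_le (I : Ideal R) (n : ℕ) :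
    (I ^ (n + 1) • ⊤ : Submodule R M) ≤ I ^ n • ⊤ :=
  Submodule.smul_mono_left (Ideal.pow_le_pow_right n.le_succ)

theorem smul_pow_smul_top (I : Ideal R) (n : ℕ) :
    I • (I ^ n • ⊤ : Submodule R M) = I ^ (n + 1) • ⊤ := by
  rw [← mul_smul, pow_succ']

variable [IsLocalRing R] [IsNoetherianRing R] [Module.Finite R M] {I : Ideal R} {k : ℕ}

/-- The hypothesis concerns only the action on `M`, so it also covers parameter ideals of `M` that
need not be primary to the maximal ideal in `R`. -/
theorem relLength_pow_smul_top_ne_top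
    (h : maximalIdeal R ^ k • (⊤ : Submodule R M) ≤ I • ⊤) (n : ℕ) :
    relLength (I ^ (n + 1) • ⊤ : Submodule R M) (I ^ n • ⊤) ≠ ⊤ := by
  refine relLength_ne_top_of_maximalIdeal_pow_smul_le (k := k) ?_
  rw [smul_comm, pow_succ, mul_smul]
  exact smul_mono_right _ h

theorem hilbertFunction_ne_top
    (h : maximalIdeal R ^ k • (⊤ : Submodule R M) ≤ I • ⊤) (n : ℕ) :
    hilbertFunction M I n ≠ ⊤ := by
  rw [hilbertFunction_eq_relLength]
  induction n with
  | zero =>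
    have := relLength_pow_smul_top_ne_top h 0
    rwa [pow_zero, one_smul] at this
  | succ n ih =>
    rw [relLength_add (pow_succ_smul_top_le I (n + 1)) le_top]
    exact WithTop.add_ne_top.mpr ⟨relLength_pow_smul_top_ne_top h (n + 1), ih⟩

theorem fwdDiff_hilbertFunction
    (h : maximalIdeal R ^ k • (⊤ : Submodule R M) ≤ I • ⊤) :
    Δ_[1] (fun n => ((hilbertFunction M I n).toNat : ℤ)) = fun n =>
      ((relLength (I ^ (n + 1 + 1) • ⊤ : Submodule R M) (I ^ (n + 1) • ⊤)).toNat : ℤ) := by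
  ext n
  have hfin := hilbertFunction_ne_top h (n + 1)
  rw [hilbertFunction_eq_relLength] at hfin
  have := relLength_toNat_add (pow_succ_smul_top_le I (n + 1)) le_top hfin
  rw [fwdDiff, hilbertFunction_eq_relLength, hilbertFunction_eq_relLength, this]
  ring

theorem eventuallyDiffZero_hilbertFunction_card (s : Finset R)
    (h : maximalIdeal R ^ k • (⊤ : Submodule R M) ≤ Ideal.span (s : Set R) • ⊤) :
    EventuallyDiffZero (s.card + 1) fun n =>
      ((hilbertFunction M (Ideal.span (s : Set R)) n).toNat : ℤ) := by
  refine EventuallyDiffZero.of_fwdDiff ?_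
  rw [fwdDiff_hilbertFunction h]
  refine (eventuallyDiffZero_relLength (Ideal.span (s : Set R)) s
    (A := fun n => Ideal.span (s : Set R) ^ (n + 1) • (⊤ : Submodule R M))
    (B := fun n => Ideal.span (s : Set R) ^ n • (⊤ : Submodule R M))
    (pow_succ_smul_top_le _) (fun n => (smul_pow_smul_top _ _).le)
    (fun n => (smul_pow_smul_top _ _).le) (fun n => le_rfl) (relLength_pow_smul_top_ne_top h)
    Ideal.subset_span ⊥ (fun n => ?_) le_sup_left).shift 1
  rw [Submodule.bot_smul]
  exact bot_le

/-- The support of a finitely generated module of dimension `t` admits a system of parameters. -/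
theorem exists_finset_card_of_supportDim_eq {t : ℕ}
    (ht : Module.supportDim R M = (t : WithBot ℕ∞)) :
    ∃ s : Finset R, s.card ≤ t ∧ Ideal.span (s : Set R) ≤ maximalIdeal R ∧
      ∃ k, maximalIdeal R ^ k • (⊤ : Submodule R M) ≤ Ideal.span (s : Set R) • ⊤ := by
  classical
  set a := Module.annihilator R M with ha
  rw [Module.supportDim_eq_ringKrullDim_quotient_annihilator, ← ha] at ht
  have hnt : Nontrivial (R ⧸ a) := by
    rw [← not_subsingleton_iff_nontrivial]
    intro hs
    rw [ringKrullDim_eq_bot_of_subsingleton] at ht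
    exact WithBot.bot_ne_coe ht
  have hloc : IsLocalRing (R ⧸ a) :=
    IsLocalRing.of_surjective' (Ideal.Quotient.mk a) Ideal.Quotient.mk_surjective
  have hlh : IsLocalHom (Ideal.Quotient.mk a) :=
    IsLocalHom.of_surjective (Ideal.Quotient.mk a) Ideal.Quotient.mk_surjective
  obtain ⟨S, hS, hcard⟩ :=
    (maximalIdeal (R ⧸ a)).exists_finset_card_eq_height_of_isNoetherianRing
  -- The parameters are found in the quotient by the annihilator, whose dimension is `t`, and then
  -- lifted by the section `σ`; the annihilator, which the lifting ignores, acts as zero on `M`.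
  have hart := quotient_artinian_of_mem_minimalPrimes_of_isLocalRing _ hS
  obtain ⟨k, hk⟩ :=
    exists_maximalIdeal_pow_le_of_isArtinianRing_quotient (Ideal.span (S : Set (R ⧸ a)))
  have hσ := Function.surjInv_eq (Ideal.Quotient.mk_surjective (I := a))
  set σ := Function.surjInv (Ideal.Quotient.mk_surjective (I := a))
  refine ⟨S.image σ, ?_, ?_, k, ?_⟩
  · refine Finset.card_image_le.trans ?_
    rw [← maximalIdeal_height_eq_ringKrullDim, ← hcard] at ht
    exact le_of_eq (by exact_mod_cast ht)
  · rw [Ideal.span_le, Finset.coe_image]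
    rintro _ ⟨x, hx, rfl⟩
    have hxm : x ∈ maximalIdeal (R ⧸ a) := hS.1.2 (Ideal.subset_span hx)
    rw [mem_maximalIdeal, ← hσ x] at hxm
    exact fun hu => hxm (hu.map _)
  · have hspan : (Ideal.span ((S.image σ : Finset R) : Set R)).map (Ideal.Quotient.mk a) =
        Ideal.span (S : Set (R ⧸ a)) := by
      rw [Ideal.map_span, Finset.coe_image, ← Set.image_comp]
      congr 1
      refine (Set.image_congr fun x _ => hσ x).trans (Set.image_id' _)
    have hle : maximalIdeal R ^ k ≤ Ideal.span ((S.image σ : Finset R) : Set R) ⊔ a := by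
      have hmap : (maximalIdeal R ^ k).map (Ideal.Quotient.mk a) ≤
          (Ideal.span ((S.image σ : Finset R) : Set R)).map (Ideal.Quotient.mk a) := by
        rw [hspan, Ideal.map_pow]
        refine (Ideal.pow_right_mono ?_ k).trans hk
        exact ((local_hom_TFAE (Ideal.Quotient.mk a)).out 0 2).mp hlh
      rw [Ideal.map_le_iff_le_comap, Ideal.comap_map_of_surjective _ Ideal.Quotient.mk_surjective,
        ← RingHom.ker_eq_comap_bot, Ideal.mk_ker] at hmap
      exact hmap
    refine (Submodule.smul_mono_left hle).trans ?_
    have hbot : a • (⊤ : Submodule R M) = ⊥ := by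
      rw [ha, ← Submodule.annihilator_top, Submodule.annihilator_smul]
    rw [Submodule.sup_smul, hbot, sup_bot_eq]

/-- The generators of `I` give polynomiality with a crude degree. A parameter ideal `J` satisfies `J
^ (k + 1) ≤ I`, so the function for `I` at `n` is bounded by that for `J` at `(k + 1) * n + k`,
which has degree at most `t`. -/
theorem eventuallyDiffZero_hilbertFunction (hmI : maximalIdeal R ^ k ≤ I) {t : ℕ}
    (ht : Module.supportDim R M = (t : WithBot ℕ∞)) :
    EventuallyDiffZero (t + 1) fun n => ((hilbertFunction M I n).toNat : ℤ) := by
  obtain ⟨s, hst, hsm, l, hl⟩ := exists_finset_card_of_supportDim_eq ht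
  set J := Ideal.span (s : Set R) with hJ
  have hk : maximalIdeal R ^ k • (⊤ : Submodule R M) ≤ I • ⊤ := Submodule.smul_mono_left hmI
  obtain ⟨u, hu⟩ : I.FG := IsNoetherian.noetherian I
  have hI : EventuallyDiffZero (u.card + 1) fun n => ((hilbertFunction M I n).toNat : ℤ) := by
    have : I = Ideal.span (u : Set R) := hu.symm
    rw [this] at hk ⊢
    exact eventuallyDiffZero_hilbertFunction_card u hk
  have hJt := ((eventuallyDiffZero_hilbertFunction_card s hl).comp_mul_add k.succ_pos k).mono
    (Nat.succ_le_succ hst)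
  refine hI.of_le hJt (Eventually.of_forall fun n => Int.natCast_nonneg _)
    (Eventually.of_forall fun n => Nat.cast_le.mpr (ENat.toNat_le_toNat ?_
      (hilbertFunction_ne_top hl _)))
  rw [hilbertFunction_eq_relLength, hilbertFunction_eq_relLength]
  refine relLength_le_of_le_left (Submodule.smul_mono_left ?_) le_top
  rw [show (k + 1) * n + k + 1 = (k + 1) * (n + 1) by ring, pow_mul]
  exact Ideal.pow_right_mono ((Ideal.pow_right_mono hsm _).trans
    ((Ideal.pow_le_pow_right k.le_succ).trans hmI)) _

end HilbertFunction

/-! ### Colon submodules of powers for large exponents. -/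

section Colon

variable {R M : Type*} [CommRing R] [AddCommGroup M] [Module R M]

theorem moduleColon_mono_left {N N' : Submodule R M} (h : N ≤ N') (J : Ideal R) :
    moduleColon N J ≤ moduleColon N' J := fun _ hx a ha => h (hx a ha)

theorem moduleColon_anti_right (N : Submodule R M) {J J' : Ideal R} (h : J ≤ J') :
    moduleColon N J' ≤ moduleColon N J := fun _ hx a ha => hx a (h ha)

theorem le_moduleColon (N : Submodule R M) (J : Ideal R) : N ≤ moduleColon N J :=
  fun _ hx a _ => N.smul_mem a hx

theorem smul_moduleColon_le (N : Submodule R M) (J : Ideal R) : J • moduleColon N J ≤ N :=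
  Submodule.smul_le.mpr fun a ha _ hx => hx a ha

theorem smul_moduleColon_le_moduleColon {I J : Ideal R} {N N' : Submodule R M}
    (h : I • N ≤ N') : I • moduleColon N J ≤ moduleColon N' J := by
  refine Submodule.smul_le.mpr fun a ha x hx b hb => ?_
  rw [smul_comm]
  exact h (Submodule.smul_mem_smul ha (hx b hb))

theorem Submodule.mem_smul_top_pi {ι : Type*} [Finite ι] (J : Ideal R) {f : ι → M}
    (h : ∀ i, f i ∈ (J • ⊤ : Submodule R M)) : f ∈ (J • ⊤ : Submodule R (ι → M)) := by
  classical
  have := Fintype.ofFinite ι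
  rw [← Finset.univ_sum_single f]
  refine Submodule.sum_mem _ fun i _ => ?_
  have h' := Submodule.mem_map_of_mem (f := LinearMap.single R (fun _ : ι => M) i) (h i)
  rw [Submodule.map_smul''] at h'
  exact (smul_mono_right J le_top : _ ≤ (J • ⊤ : Submodule R (ι → M))) h'

variable [IsNoetherianRing R] [Module.Finite R M] (I : Ideal R)

/-- Let `φ` send `x` to its multiples by generators of `I`, so that its kernel is `0 :_M I`.
Artin-Rees for the range of `φ` places `φ x` in `φ (I ^ (n - k) M)`, and `x` is corrected by a
preimage. -/
theorem exists_moduleColon_pow_smul_top_le :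
    ∃ k, ∀ n ≥ k, moduleColon (I ^ n • ⊤ : Submodule R M) I ≤
      moduleColon ⊥ I ⊔ I ^ (n - k) • ⊤ := by
  obtain ⟨s, hs⟩ : I.FG := IsNoetherian.noetherian I
  let φ : M →ₗ[R] (s → M) := LinearMap.pi fun a => LinearMap.lsmul R M a
  obtain ⟨k, hk⟩ := I.exists_pow_inf_eq_pow_smul (LinearMap.range φ)
  refine ⟨k, fun n hn x hx => ?_⟩
  have hφx : φ x ∈ (I ^ n • ⊤ ⊓ LinearMap.range φ : Submodule R (s → M)) := by
    refine ⟨Submodule.mem_smul_top_pi _ fun a => hx a ?_, x, rfl⟩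
    rw [← hs]
    exact Submodule.subset_span a.2
  rw [hk n hn] at hφx
  have hle : I ^ (n - k) • (I ^ k • ⊤ ⊓ LinearMap.range φ) ≤ I ^ (n - k) • LinearMap.range φ :=
    smul_mono_right _ inf_le_right
  have hmem := hle hφx
  rw [LinearMap.range_eq_map, ← Submodule.map_smul''] at hmem
  obtain ⟨z, hz, hzx⟩ := hmem
  refine Submodule.mem_sup.mpr ⟨x - z, ?_, z, hz, sub_add_cancel x z⟩
  have hker : (s : Set R) ⊆ LinearMap.ker (LinearMap.toSpanSingleton R M (x - z)) := by
    intro a ha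
    have := congrFun hzx ⟨a, ha⟩
    change a • z = a • x at this
    change a • (x - z) = 0
    rw [smul_sub, this, sub_self]
  exact fun a ha => Ideal.span_le.mpr hker (hs.ge ha)

/-- The Rees stability of `(I ^ (n + 2) M :_M I) ∩ I ^ n M` writes each late term as `I` times the
previous one, which pushes it one power of `I` deeper. Repeating this climbs from `I ^ c M` to `I ^
n M`. -/
theorem eventually_moduleColon_inf_pow_smul_top_le :
    ∀ᶠ c in atTop, ∀ n ≥ c,
      moduleColon (I ^ (n + 1) • ⊤ : Submodule R M) I ⊓ I ^ c • ⊤ ≤ I ^ n • ⊤ := by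
  have h := eventually_eq_smul_of_le_pow_smul I (M := M)
    (B := fun n => moduleColon (I ^ (n + 2) • ⊤) I ⊓ I ^ n • ⊤)
    (fun n => le_inf ((smul_mono_right I inf_le_left).trans
        (smul_moduleColon_le_moduleColon (smul_pow_smul_top I _).le))
      ((smul_mono_right I inf_le_right).trans (smul_pow_smul_top I _).le))
    fun n => inf_le_right
  obtain ⟨N, hN⟩ := eventually_atTop.mp h
  have hstep : ∀ j > N,
      moduleColon (I ^ (j + 2) • ⊤ : Submodule R M) I ⊓ I ^ j • ⊤ ≤ I ^ (j + 1) • ⊤ := by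
    intro j hj
    obtain ⟨i, rfl⟩ := Nat.exists_eq_add_of_le' (Nat.one_le_of_lt hj)
    rw [hN i (by omega)]
    exact (smul_mono_right I inf_le_left).trans (smul_moduleColon_le _ _)
  refine eventually_atTop.mpr ⟨N + 1, fun c hc n hn => ?_⟩
  have key : ∀ j ≥ c, j ≤ n →
      moduleColon (I ^ (n + 1) • ⊤ : Submodule R M) I ⊓ I ^ c • ⊤ ≤ I ^ j • ⊤ := by
    intro j hj
    induction j, hj using Nat.le_induction with
    | base => exact fun _ => inf_le_right
    | succ j hj ih =>
      intro hjn
      refine le_trans (le_inf (inf_le_left.trans ?_) (ih (by omega))) (hstep j (by omega))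
      exact moduleColon_mono_left
        (Submodule.smul_mono_left (Ideal.pow_le_pow_right (by omega))) I
  exact key n hn le_rfl

theorem eventually_moduleColon_bot_inf_pow_smul_top_eq_bot :
    ∀ᶠ n in atTop, moduleColon (⊥ : Submodule R M) I ⊓ I ^ n • ⊤ = ⊥ := by
  obtain ⟨k, hk⟩ := I.exists_pow_inf_eq_pow_smul (moduleColon (⊥ : Submodule R M) I)
  refine eventually_atTop.mpr ⟨k + 1, fun n hn => ?_⟩
  rw [inf_comm, hk n (by omega), eq_bot_iff]
  refine (smul_mono_right _ inf_le_right).trans (le_trans ?_ (smul_moduleColon_le ⊥ I))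
  exact Submodule.smul_mono_left (Ideal.pow_le_self (by omega))

theorem eventually_moduleColon_pow_smul_top_eq_sup {J : Ideal R} (hIJ : I ≤ J) :
    ∀ᶠ n in atTop, moduleColon (I ^ (n + 1) • ⊤ : Submodule R M) J =
      (moduleColon (I ^ (n + 1) • ⊤) J ⊓ I ^ n • ⊤) ⊔ moduleColon ⊥ J := by
  obtain ⟨k, hk⟩ := exists_moduleColon_pow_smul_top_le (M := M) I
  obtain ⟨c, hc⟩ := (eventually_moduleColon_inf_pow_smul_top_le (M := M) I).exists
  filter_upwards [eventually_moduleColon_bot_inf_pow_smul_top_eq_bot (M := M) I,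
    eventually_ge_atTop (k + c)] with n hbot hn
  refine le_antisymm (fun x hx => ?_) (sup_le inf_le_left (moduleColon_mono_left bot_le J))
  have hxI := moduleColon_anti_right _ hIJ hx
  obtain ⟨y, hy, z, hz, rfl⟩ := Submodule.mem_sup.mp (hk (n + 1) (by omega) hxI)
  have hzI : z ∈ moduleColon (I ^ (n + 1) • ⊤ : Submodule R M) I := by
    have := Submodule.sub_mem _ hxI (moduleColon_mono_left bot_le I hy)
    rwa [add_sub_cancel_left] at this
  have hzn : z ∈ (I ^ n • ⊤ : Submodule R M) := hc n (by omega)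
    ⟨hzI, Submodule.smul_mono_left (Ideal.pow_le_pow_right (by omega)) hz⟩
  -- For `a ∈ J`, the element `a y = a x - a z` lies in both `0 :_M I` and `I ^ n M`, whose
  -- intersection is zero.
  have hyJ : y ∈ moduleColon (⊥ : Submodule R M) J := by
    intro a ha
    rw [← hbot]
    refine ⟨Submodule.smul_mem _ a hy, ?_⟩
    have := Submodule.sub_mem _ (pow_succ_smul_top_le I n (hx a ha)) (Submodule.smul_mem _ a hzn)
    rwa [smul_add, add_sub_cancel_right] at this
  have hzJ : z ∈ moduleColon (I ^ (n + 1) • ⊤ : Submodule R M) J := by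
    have := Submodule.sub_mem _ hx (moduleColon_mono_left bot_le J hyJ)
    rwa [add_sub_cancel_left] at this
  rw [add_comm y z]
  exact Submodule.add_mem_sup ⟨hzJ, hzn⟩ hyJ

end Colon

/-! ### The irreducibility function and the socle of the associated graded module. -/

section Irreducibility

open fwdDiff

variable {R M : Type*} [CommRing R] [IsLocalRing R] [IsNoetherianRing R]
  [AddCommGroup M] [Module R M] [Module.Finite R M] {I : Ideal R}

/-- The degree `n` part of the socle of the associated graded module of `M` is the quotient of
this submodule by `I ^ (n + 1) M`. -/
def gradedSocle (M : Type*) [AddCommGroup M] [Module R M] (I : Ideal R) (n : ℕ) : Submodule R M :=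
  moduleColon (I ^ (n + 1) • ⊤) (maximalIdeal R) ⊓ I ^ n • ⊤

omit [IsNoetherianRing R] [Module.Finite R M] in
theorem le_gradedSocle (n : ℕ) : I ^ (n + 1) • ⊤ ≤ gradedSocle M I n :=
  le_inf (le_moduleColon _ _) (pow_succ_smul_top_le I n)

theorem irreducibilityFunction_eventually_eq (hIm : I ≤ maximalIdeal R) :
    ∀ᶠ n in atTop, irreducibilityFunction M I n =
      relLength (I ^ (n + 1) • ⊤) (gradedSocle M I n) +
        Module.length R (moduleColon (⊥ : Submodule R M) (maximalIdeal R)) := by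
  filter_upwards [eventually_moduleColon_pow_smul_top_eq_sup (M := M) I hIm,
    eventually_moduleColon_bot_inf_pow_smul_top_eq_bot (M := M) I] with n hn hbot
  change relLength (I ^ (n + 1) • ⊤ : Submodule R M)
    (moduleColon (I ^ (n + 1) • ⊤ : Submodule R M) (maximalIdeal R)) = _
  have h : gradedSocle M I n ≤ moduleColon (I ^ (n + 1) • ⊤) (maximalIdeal R) := inf_le_left
  have hinf : gradedSocle M I n ⊓ moduleColon (⊥ : Submodule R M) (maximalIdeal R) = ⊥ := by
    rw [eq_bot_iff, inf_comm]
    exact (inf_le_inf (moduleColon_anti_right _ hIm) inf_le_right).trans hbot.le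
  rw [relLength_add (le_gradedSocle n) h]
  change _ = gradedSocle M I n ⊔ _ at hn
  rw [hn, relLength_sup, hinf, relLength_bot]

theorem length_moduleColon_bot_ne_top :
    Module.length R (moduleColon (⊥ : Submodule R M) (maximalIdeal R)) ≠ ⊤ := by
  rw [← relLength_bot]
  refine relLength_ne_top_of_maximalIdeal_pow_smul_le (k := 1) ?_
  rw [pow_one]
  exact smul_moduleColon_le _ _

theorem irreducibilityFunction_ne_top (n : ℕ) : irreducibilityFunction M I n ≠ ⊤ := by
  refine relLength_ne_top_of_maximalIdeal_pow_smul_le (k := 1) ?_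
  rw [pow_one]
  exact smul_moduleColon_le _ _

theorem relLength_gradedSocle_ne_top (n : ℕ) :
    relLength (I ^ (n + 1) • ⊤) (gradedSocle M I n) ≠ ⊤ := by
  refine relLength_ne_top_of_maximalIdeal_pow_smul_le (k := 1) ?_
  rw [pow_one]
  exact (smul_mono_right _ inf_le_left).trans (smul_moduleColon_le _ _)

theorem irreducibilityFunction_toNat_eventuallyEq (hIm : I ≤ maximalIdeal R) :
    (fun n => ((irreducibilityFunction M I n).toNat : ℤ)) =ᶠ[atTop]
      (fun n => ((relLength (I ^ (n + 1) • ⊤) (gradedSocle M I n)).toNat : ℤ)) +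
        fun _ => ((Module.length R
          (moduleColon (⊥ : Submodule R M) (maximalIdeal R))).toNat : ℤ) := by
  filter_upwards [irreducibilityFunction_eventually_eq (M := M) hIm] with n hn
  rw [hn, ENat.toNat_add (relLength_gradedSocle_ne_top n) length_moduleColon_bot_ne_top,
    Nat.cast_add]
  rfl

omit [IsNoetherianRing R] [Module.Finite R M] in
theorem irreducibilityFunction_le_hilbertFunction (n : ℕ) :
    irreducibilityFunction M I n ≤ hilbertFunction M I n := by
  rw [hilbertFunction_eq_relLength]
  exact relLength_le_of_le (le_moduleColon _ _) le_top

/-- Any `d` suffices here: comparison with the graded pieces of `M` later replaces it by `t`. -/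
theorem eventuallyDiffZero_relLength_gradedSocle :
    ∃ d, EventuallyDiffZero d fun n =>
      ((relLength (I ^ (n + 1) • ⊤) (gradedSocle M I n)).toNat : ℤ) := by
  obtain ⟨s, hs⟩ : I.FG := IsNoetherian.noetherian I
  refine ⟨s.card, eventuallyDiffZero_relLength I s le_gradedSocle
    (fun n => (smul_pow_smul_top _ _).le) (fun n => ?_) (fun n => inf_le_right)
    relLength_gradedSocle_ne_top ?_ ⊥ (fun n => ?_) ?_⟩
  · exact le_inf ((smul_mono_right I inf_le_left).trans
      (smul_moduleColon_le_moduleColon (smul_pow_smul_top I _).le))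
      ((smul_mono_right I inf_le_right).trans (smul_pow_smul_top I _).le)
  · rw [← hs]
    exact Submodule.subset_span
  · rw [Submodule.bot_smul]
    exact bot_le
  · rw [sup_bot_eq]
    exact hs.ge

omit [IsNoetherianRing R] [Module.Finite R M] in
theorem gradedSocle_eq_of_maximalIdeal_eq_colon {m n : ℕ}
    (hm : maximalIdeal R =
      (I ^ (m + 1) • ⊤ : Submodule R M).colon ((I ^ m • ⊤ : Submodule R M) : Set M))
    (hmn : m ≤ n) : gradedSocle M I n = I ^ n • ⊤ := by
  have hsmul : maximalIdeal R • (I ^ m • ⊤ : Submodule R M) ≤ I ^ (m + 1) • ⊤ :=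
    Submodule.smul_le.mpr fun a ha x hx => by
      rw [hm, Submodule.mem_colon] at ha
      exact ha x hx
  have hsmul' : maximalIdeal R • (I ^ n • ⊤ : Submodule R M) ≤ I ^ (n + 1) • ⊤ := by
    obtain ⟨i, rfl⟩ := Nat.exists_eq_add_of_le' hmn
    rw [add_assoc, pow_add, mul_smul, smul_comm, pow_add I i, mul_smul]
    exact smul_mono_right _ hsmul
  exact inf_eq_right.mpr fun x hx a ha => hsmul' (Submodule.smul_mem_smul ha hx)

theorem fwdDiff_iter_relLength_pow_smul_top_eventually_eq {k r : ℕ} {e : ℤ}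
    (hk : maximalIdeal R ^ k • (⊤ : Submodule R M) ≤ I • ⊤)
    (h : ∀ᶠ n in atTop, (Δ_[1])^[r + 1] (fun n => ((hilbertFunction M I n).toNat : ℤ)) n = e) :
    ∀ᶠ n in atTop, (Δ_[1])^[r] (fun n =>
      ((relLength (I ^ (n + 1) • ⊤ : Submodule R M) (I ^ n • ⊤)).toNat : ℤ)) n = e := by
  rw [← map_add_atTop_eq_nat 1, eventually_map]
  filter_upwards [h] with n hn
  rw [Function.iterate_succ_apply, fwdDiff_hilbertFunction hk] at hn
  rw [← hn]
  exact (fwdDiff_iter_comp_add 1 (fun n =>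
    ((relLength (I ^ (n + 1) • ⊤ : Submodule R M) (I ^ n • ⊤)).toNat : ℤ)) 1 r n).symm

end Irreducibility

/-! ### Comparison of the leading coefficients. -/

theorem theorem1p1 {R M : Type*} [CommRing R] [IsLocalRing R] [IsNoetherianRing R]
    [AddCommGroup M] [Module R M] [Module.Finite R M]
    (I : Ideal R) (hI : I.radical = maximalIdeal R)
    (t : ℕ) (ht : Module.supportDim R M = (t : WithBot ℕ∞)) :
    (∃! e : Fin (t + 1) → ℤ, IsBinomialCoefficients (hilbertFunction M I) t e) ∧
    (∃! f : Fin (t - 1 + 1) → ℤ,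
      IsBinomialCoefficients (irreducibilityFunction M I) (t - 1) f) ∧
    Module.length R (moduleColon (⊥ : Submodule R M) (maximalIdeal R)) ≠ ⊤ ∧
    (t ≠ 1 → irreducibleMultiplicity M I t ≤ hilbertMultiplicity M I t) ∧
    (t = 1 → irreducibleMultiplicity M I t ≤ hilbertMultiplicity M I t +
      ((Module.length R (moduleColon (⊥ : Submodule R M) (maximalIdeal R))).toNat : ℤ)) ∧
    (1 ≤ t →
      (∃ n : ℕ, maximalIdeal R =
        (I ^ (n + 1) • ⊤ : Submodule R M).colon
          ((I ^ n • ⊤ : Submodule R M) : Set M)) →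
      (t ≠ 1 → irreducibleMultiplicity M I t = hilbertMultiplicity M I t) ∧
      (t = 1 → irreducibleMultiplicity M I t = hilbertMultiplicity M I t +
        ((Module.length R (moduleColon (⊥ : Submodule R M) (maximalIdeal R))).toNat : ℤ))) := by
  have hIm : I ≤ maximalIdeal R := hI ▸ Ideal.le_radical
  obtain ⟨k, hmI⟩ : ∃ k, maximalIdeal R ^ k ≤ I :=
    Ideal.exists_pow_le_of_le_radical_of_fg hI.ge (IsNoetherian.noetherian _)
  have hk : maximalIdeal R ^ k • (⊤ : Submodule R M) ≤ I • ⊤ := Submodule.smul_mono_left hmI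
  have hH := eventuallyDiffZero_hilbertFunction hmI ht
  have hF := irreducibilityFunction_toNat_eventuallyEq (M := M) hIm
  set H : ℕ → ℤ := fun n => ((hilbertFunction M I n).toNat : ℤ) with hHdef
  set F : ℕ → ℤ := fun n => ((irreducibilityFunction M I n).toNat : ℤ) with hFdef
  set L : ℕ → ℤ := fun n =>
    ((relLength (I ^ (n + 1) • ⊤) (gradedSocle M I n)).toNat : ℤ) with hLdef
  set G : ℕ → ℤ := fun n =>
    ((relLength (I ^ (n + 1) • ⊤ : Submodule R M) (I ^ n • ⊤)).toNat : ℤ) with hGdef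
  set z : ℤ :=
    ((Module.length R (moduleColon (⊥ : Submodule R M) (maximalIdeal R))).toNat : ℤ)
  have hLG : ∀ n, L n ≤ G n := fun n => Nat.cast_le.mpr (ENat.toNat_le_toNat
    (relLength_le_of_le (le_gradedSocle n) inf_le_right) (relLength_pow_smul_top_ne_top hk n))
  have hG : EventuallyDiffZero t G := by
    have := hH.fwdDiff
    rw [hHdef, fwdDiff_hilbertFunction hk] at this
    exact EventuallyDiffZero.of_shift (m := 1) this
  have hL : EventuallyDiffZero t L := by
    obtain ⟨d, hd⟩ := eventuallyDiffZero_relLength_gradedSocle (M := M) (I := I)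
    exact hd.of_le hG (Eventually.of_forall fun n => Int.natCast_nonneg _)
      (Eventually.of_forall hLG)
  -- The order `t - 1 + 1` is `max t 1`: even when `t = 0`, one difference is needed to kill the
  -- constant `z`.
  have hFd : EventuallyDiffZero (t - 1 + 1) F :=
    ((hL.mono (by omega)).add (EventuallyDiffZero.const z)).congr hF
  have he := existsUnique_isBinomialCoefficients
    (Eventually.of_forall (hilbertFunction_ne_top hk)) hH
  have hf := existsUnique_isBinomialCoefficients
    (Eventually.of_forall fun n => irreducibilityFunction_ne_top (M := M) (I := I) n) hFd
  have hHlead := fwdDiff_iter_eventually_eq_leadingBinomialCoefficient he.exists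
  have hFlead := fwdDiff_iter_eventually_eq_leadingBinomialCoefficient hf.exists
  refine ⟨he, hf, length_moduleColon_bot_ne_top, ?_⟩
  rw [irreducibleMultiplicity, hilbertMultiplicity]
  set e₀ := leadingBinomialCoefficient (hilbertFunction M I) t
  set f₀ := leadingBinomialCoefficient (irreducibilityFunction M I) (t - 1)
  cases t with
  | zero =>
    refine ⟨fun _ => ?_, fun h => absurd h zero_ne_one, fun h => absurd h (by omega)⟩
    -- For `t = 0` both functions are eventually constant and are compared directly.
    refine le_of_fwdDiff_iter_eventually_eq (d := 0) (f := F) (g := H)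
      (Eventually.of_forall fun n => ?_) hFlead hHlead
    exact Nat.cast_le.mpr (ENat.toNat_le_toNat (irreducibilityFunction_le_hilbertFunction n)
      (hilbertFunction_ne_top hk n))
  | succ r =>
    rw [Nat.add_sub_cancel] at hFlead
    have hGlead := fwdDiff_iter_relLength_pow_smul_top_eventually_eq hk hHlead
    -- The constant `z` survives `r` differences only if `r = 0`, which is why `t = 1` is
    -- exceptional.
    have hGz : ∀ᶠ n in atTop, (fwdDiff 1)^[r] (G + fun _ => z) n =
        e₀ + if r = 0 then z else 0 := by
      filter_upwards [hGlead] with n hn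
      rw [fwdDiff_iter_add, Pi.add_apply, hn]
      congr 1
      cases r with
      | zero => rfl
      | succ r =>
        rw [Function.iterate_succ_apply, fwdDiff_const, if_neg r.succ_ne_zero]
        exact congrFun (Function.iterate_fixed (fwdDiff_const (M := ℕ) 1 (0 : ℤ)) r) n
    have hle : f₀ ≤ e₀ + if r = 0 then z else 0 := by
      refine le_of_fwdDiff_iter_eventually_eq ?_ hFlead hGz
      filter_upwards [hF] with n hn
      exact hn.le.trans (add_le_add_left (hLG n) z)
    have heq : (∃ n : ℕ, maximalIdeal R =
        (I ^ (n + 1) • ⊤ : Submodule R M).colon ((I ^ n • ⊤ : Submodule R M) : Set M)) →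
        f₀ = e₀ + if r = 0 then z else 0 := by
      rintro ⟨m, hm⟩
      have hLG' : F =ᶠ[atTop] G + fun _ => z := by
        filter_upwards [hF, eventually_ge_atTop m] with n hn hmn
        rw [hn, Pi.add_apply, Pi.add_apply, hLdef, hGdef]
        simp only
        rw [gradedSocle_eq_of_maximalIdeal_eq_colon hm hmn]
      obtain ⟨n, h₁, h₂, h₃⟩ :=
        ((fwdDiff_iter_eventuallyEq hLG' r).and (hFlead.and hGz)).exists
      rw [← h₂, ← h₃]
      exact h₁
    have hr : r + 1 = 1 ↔ r = 0 := by omega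
    rw [Ne, hr]
    refine ⟨fun h => ?_, fun h => ?_, fun _ hex => ⟨fun h => ?_, fun h => ?_⟩⟩
    · rwa [if_neg h, add_zero] at hle
    · rwa [if_pos h] at hle
    · have := heq hex
      rwa [if_neg h, add_zero] at this
    · have := heq hex
      rwa [if_pos h] at this
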